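/- Let $p$ be a prime, $r\ge 1$ and $n\ge 0$ integers, $R=\mathbb{Z}_{p^r}$, $\mathcal{A}=\{0,\dots,p-1\}\subset R$, and let $\mathcal{A}[D]$ and $\mathcal{A}((D))$ be the sets of polynomials and of Laurent series over $R$ with all coefficients in $\mathcal{A}$. The weight $\mathrm{wt}$ of a vector of Laurent series is the total number of nonzero coefficients of its components. A free convolutional code of length $n$ over $R$ is a submodule $\mathcal{C}=\{u(D)G_0(D) : u(D)\in R((D))^{m}\}$ of $R((D))^n$, where $G_0(D)\in R[D]^{m\times n}$ for some $m$ and the rows of $G_0(D)$ are linearly independent over $R((D))$. Vectors in $R[D]^n$ (resp. in $R^n$) are called $p$-linearly independent if the only linear combination of them with coefficients in $\mathcal{A}[D]$ (resp. in $\mathcal{A}$) that equals $0$ is the one whose coefficients are all $0$. For a matrix $G(D)\in R[D]^{k\times n}$ with nonzero rows $g_1(D),\dots,g_k(D)$, let $G^{lrc}\in R^{k\times n}$ be the matrix whose $i$-th row is the coefficient vector of $D^{d_i}$ in $g_i(D)$, where $d_i$ is the highest degree of the entries of $g_i(D)$. **Theorem.** Every free convolutional code $\mathcal{C}$ of length $n$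 over $\mathbb{Z}_{p^r}$ admits a minimal $p$-encoder, that is, there are $k\ge 0$ and a matrix $G(D)\in R[D]^{k\times n}$ with rows $g_1(D),\dots,g_k(D)$ such that: 1. ($p$-encoder) $g_1(D),\dots,g_k(D)$ are $p$-linearly independent; for each $i\in\{1,\dots,k\}$ the vector $p\,g_i(D)$ is a linear combination of $g_{i+1}(D),\dots,g_k(D)$ with coefficients in $\mathcal{A}[D]$ (in particular $p\,g_k(D)=0$); and $\mathcal{C}=\{u(D)G(D) : u(D)\in\mathcal{A}((D))^k\}$; 2. (delay-free) the rows of $G(0)$ are $p$-linearly independent; 3. (noncatastrophic) for every $u(D)\in\mathcal{A}((D))^k$, $\mathrm{wt}[u(D)G(D)]<\infty$ if and only if $\mathrm{wt}[u(D)]<\infty$; 4. (reduced) the rows of $G^{lrc}$ are $p$-linearly independent. -/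

import Mathlib

noncomputable section

namespace ConvCode

/-- The set `𝒜 = {0, …, p - 1}` of digits, as a subset of `ℤ / p ^ r`. -/
def digits (p r : ℕ) : Set (ZMod (p ^ r)) :=
  {a | ∃ m : ℕ, m < p ∧ a = (m : ZMod (p ^ r))}

/-- `𝒜[D]`: the polynomials all of whose coefficients are digits. -/
def digitPolynomials (p r : ℕ) : Set (Polynomial (ZMod (p ^ r))) :=
  {a | ∀ i : ℕ, a.coeff i ∈ digits p r}

/-- `𝒜((D))`: the Laurent series all of whose coefficients are digits. -/
def digitLaurent (p r : ℕ) : Set (LaurentSeries (ZMod (p ^ r))) :=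
  {u | ∀ i : ℤ, u.coeff i ∈ digits p r}

/-- The inclusion of the polynomial ring `R[D]` into the ring `R((D))` of Laurent series. -/
def toLaurent (R : Type*) [CommRing R] : Polynomial R →+* LaurentSeries R :=
  (HahnSeries.ofPowerSeries ℤ R).comp Polynomial.coeToPowerSeries.ringHom

/-- A polynomial matrix, regarded as a matrix over the ring of Laurent series. -/
def laurentMatrix {R : Type*} [CommRing R] {k n : ℕ}
    (G : Matrix (Fin k) (Fin n) (Polynomial R)) : Matrix (Fin k) (Fin n) (LaurentSeries R) :=
  G.map (toLaurent R)

/-- The Hamming weight of a vector of Laurent series: the total number of nonzero coefficients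
of its components. -/
def weight {R : Type*} [CommRing R] {m : ℕ} (u : Fin m → LaurentSeries R) : ℕ∞ :=
  ∑ i, {j : ℤ | (u i).coeff j ≠ 0}.encard

/-- `G` is a polynomial generator matrix of `C`: the code `C` is the image of `u ↦ u G` over the
ring of Laurent series. -/
def IsGeneratorMatrix {R : Type*} [CommRing R] {k n : ℕ}
    (G : Matrix (Fin k) (Fin n) (Polynomial R))
    (C : Submodule (LaurentSeries R) (Fin n → LaurentSeries R)) : Prop :=
  C = LinearMap.range (Matrix.vecMulLinear (laurentMatrix G))

/-- `G` is an encoder of `C`: a polynomial generator matrix of full row rank, i.e. whose rows are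
linearly independent over the ring of Laurent series. -/
def IsEncoder {R : Type*} [CommRing R] {k n : ℕ}
    (G : Matrix (Fin k) (Fin n) (Polynomial R))
    (C : Submodule (LaurentSeries R) (Fin n → LaurentSeries R)) : Prop :=
  IsGeneratorMatrix G C ∧ LinearIndependent (LaurentSeries R) (laurentMatrix G).row

/-- A free convolutional code of length `n` over `R`: a code that has an encoder. -/
def IsFreeConvolutionalCode {R : Type*} [CommRing R] {n : ℕ}
    (C : Submodule (LaurentSeries R) (Fin n → LaurentSeries R)) : Prop :=
  ∃ (k : ℕ) (G : Matrix (Fin k) (Fin n) (Polynomial R)), IsEncoder G C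

/-- The `p`-span of the vectors `v j`, `j ∈ s`: all combinations with coefficients in `𝒜[D]`. -/
def pSpan (p r : ℕ) {k n : ℕ} (s : Finset (Fin k))
    (v : Fin k → Fin n → Polynomial (ZMod (p ^ r))) : Set (Fin n → Polynomial (ZMod (p ^ r))) :=
  {w | ∃ a : Fin k → Polynomial (ZMod (p ^ r)),
    (∀ j, a j ∈ digitPolynomials p r) ∧ w = ∑ j ∈ s, a j • v j}

/-- `p`-generator sequence: `p v i` is a `p`-linear combination of the vectors that follow `v i`
(so that `p v k = 0` for the last vector `v k`). -/
def IsPGeneratorSequence (p r : ℕ) {k n : ℕ}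
    (v : Fin k → Fin n → Polynomial (ZMod (p ^ r))) : Prop :=
  ∀ i, (p : Polynomial (ZMod (p ^ r))) • v i ∈ pSpan p r (Finset.Ioi i) v

/-- `p`-linear independence of polynomial vectors: only the trivial combination with coefficients
in `𝒜[D]` is zero. -/
def PLinearIndependent (p r : ℕ) {k n : ℕ}
    (v : Fin k → Fin n → Polynomial (ZMod (p ^ r))) : Prop :=
  ∀ a : Fin k → Polynomial (ZMod (p ^ r)), (∀ j, a j ∈ digitPolynomials p r) →
    ∑ j, a j • v j = 0 → ∀ j, a j = 0

/-- `p`-linear independence of constant vectors: only the trivial combination with coefficients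
in `𝒜` is zero. -/
def PLinearIndependentConst (p r : ℕ) {k n : ℕ} (c : Fin k → Fin n → ZMod (p ^ r)) : Prop :=
  ∀ a : Fin k → ZMod (p ^ r), (∀ j, a j ∈ digits p r) → ∑ j, a j • c j = 0 → ∀ j, a j = 0

/-- The row degree of a polynomial vector: the highest degree of its components. -/
def rowDegree {R : Type*} [CommRing R] {n : ℕ} (v : Fin n → Polynomial R) : ℕ :=
  Finset.univ.sup fun j => (v j).natDegree

/-- The leading row coefficient matrix: its `i`-th row is the coefficient vector of `D ^ d` in the
`i`-th row of `G`, where `d` is the degree of that row. -/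
def leadingRowCoeff {R : Type*} [CommRing R] {k n : ℕ}
    (G : Matrix (Fin k) (Fin n) (Polynomial R)) : Matrix (Fin k) (Fin n) R :=
  Matrix.of fun i j => (G i j).coeff (rowDegree (G i))

/-- `p`-encoder of the code `C`. -/
structure IsPEncoder (p r : ℕ) {k n : ℕ}
    (G : Matrix (Fin k) (Fin n) (Polynomial (ZMod (p ^ r))))
    (C : Submodule (LaurentSeries (ZMod (p ^ r))) (Fin n → LaurentSeries (ZMod (p ^ r)))) :
    Prop where
  pLinearIndependent : PLinearIndependent p r G.row
  pGeneratorSequence : IsPGeneratorSequence p r G.row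
  image_eq : (C : Set (Fin n → LaurentSeries (ZMod (p ^ r)))) =
    {v | ∃ u : Fin k → LaurentSeries (ZMod (p ^ r)),
      (∀ j, u j ∈ digitLaurent p r) ∧ v = Matrix.vecMul u (laurentMatrix G)}

/-- A matrix is noncatastrophic for inputs with coefficients in `𝒜` if such an input has finite
weight exactly when the output has finite weight. -/
def PNoncatastrophic (p r : ℕ) {k n : ℕ}
    (G : Matrix (Fin k) (Fin n) (Polynomial (ZMod (p ^ r)))) : Prop :=
  ∀ u : Fin k → LaurentSeries (ZMod (p ^ r)), (∀ j, u j ∈ digitLaurent p r) →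
    (weight (Matrix.vecMul u (laurentMatrix G)) < ⊤ ↔ weight u < ⊤)

/-- The matrix `G` is delay-free: the rows of `G(0)` are `p`-linearly independent. -/
def DelayFree (p r : ℕ) {k n : ℕ}
    (G : Matrix (Fin k) (Fin n) (Polynomial (ZMod (p ^ r)))) : Prop :=
  PLinearIndependentConst p r (G.map (Polynomial.eval 0)).row

/-- Minimal `p`-encoder of the code `C`: a delay-free noncatastrophic `p`-encoder whose leading row
coefficient matrix has `p`-linearly independent rows (so that its rows form a reduced `p`-basis of
the module that they span). -/
structure IsMinimalPEncoder (p r : ℕ) {k n : ℕ}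
    (G : Matrix (Fin k) (Fin n) (Polynomial (ZMod (p ^ r))))
    (C : Submodule (LaurentSeries (ZMod (p ^ r))) (Fin n → LaurentSeries (ZMod (p ^ r)))) :
    Prop where
  pEncoder : IsPEncoder p r G C
  delayFree : DelayFree p r G
  noncatastrophic : PNoncatastrophic p r G
  reduced : PLinearIndependentConst p r (leadingRowCoeff G).row

end ConvCode

end

/-!
Write `R = ℤ / p ^ r`. The minimal `p`-encoder is a reduced `p`-basis of the `R[D]`-module
`M = C ∩ R[D] ^ n` of polynomial vectors of the code (`polynomialPart`).

For each degree `e`, the coefficient vectors at `D ^ e` of the elements of `M` of degree at most `e`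
form a submodule of `R ^ n` (`leadingCoeffs`). As `R ^ n` is Noetherian and `p` is nilpotent, these
submodules are refined by a composition series of their sum: a sequence `v` of vectors, listed from
the top, each of which lies outside the span of the later ones although `p` times it lies inside
(`exists_isAdaptedSequence`). Such a sequence behaves like a basis with respect to the digits
`0, …, p - 1`: combinations with digits exhaust its span because every scalar is a digit plus a
multiple of `p` (`exists_digits_of_mem_span`), and they are unique because the difference of two
distinct digits is a unit (`isUnit_sub_of_digits`, `eq_zero_of_sum_smul_eq_zero`).

Lift each `v i` to an element `g i` of `M` with that leading coefficient vector. The top coefficient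
of a combination of the `g i` is then a combination of the `v i`, so the properties of `v` pass to
`g` by induction on the degree: every element of `M` is a unique combination of the `g i` with
coefficients in `𝒜[D]` (`IsLeadingLift.exists_digits`, `IsLeadingLift.digits_unique`), and `g` is a
`p`-generator sequence and reduced.

The remaining properties hold because `D m ∈ M` implies `m ∈ M`. If two digit combinations of the
constant terms `g i (0)` agree, then the difference of the corresponding combinations of the `g i`
is `D` times an element of `M`, and uniqueness in `M` shows that the digits agree
(`IsLeadingLift.eq_of_sum_mul_coeff_zero_eq`). This is delay-freeness, and comparing coefficients
one after the other it gives uniqueness of combinations with coefficients in `𝒜[[D]]`. A vector of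
`C` without negative powers of `D` has the same constant term as some element of `M`
(`exists_mem_polynomialPart_coeff_zero`); subtracting a digit combination and dividing by `D`
repeatedly gives its digit expansion, so that the image of the encoder is all of `C`. Finally, an
output of finite weight is, up to a power of `D`, an element of `M`, hence a combination with
coefficients in `𝒜[D]`; by uniqueness these are the input, which therefore has finite weight.
-/

namespace ConvCode

open Polynomial

/-! ### Digits -/

theorem zero_mem_digits {p : ℕ} (hp : p.Prime) (r : ℕ) : (0 : ZMod (p ^ r)) ∈ digits p r :=
  ⟨0, hp.pos, by simp⟩

theorem exists_digit_add_mul {p r : ℕ} (hp : p.Prime) (x : ZMod (p ^ r)) :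
    ∃ a ∈ digits p r, ∃ y, x = a + y * (p : ZMod (p ^ r)) := by
  have : NeZero (p ^ r) := ⟨pow_ne_zero _ hp.ne_zero⟩
  refine ⟨((x.val % p : ℕ) : ZMod (p ^ r)), ⟨_, Nat.mod_lt _ hp.pos, rfl⟩,
    ((x.val / p : ℕ) : ZMod (p ^ r)), ?_⟩
  rw [← Nat.cast_mul, ← Nat.cast_add, Nat.mod_add_div', ZMod.natCast_zmod_val]

theorem isUnit_sub_of_digits {p r : ℕ} (hp : p.Prime) {a b : ZMod (p ^ r)}
    (ha : a ∈ digits p r) (hb : b ∈ digits p r) (hab : a ≠ b) : IsUnit (a - b) := by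
  have key : ∀ m m' : ℕ, m < p → m' < m →
      IsUnit ((m : ZMod (p ^ r)) - (m' : ZMod (p ^ r))) := by
    intro m m' hm h
    rw [← Nat.cast_sub h.le, ZMod.isUnit_iff_coprime]
    exact ((Nat.coprime_of_lt_prime (Nat.sub_pos_of_lt h).ne' ((Nat.sub_le m m').trans_lt hm) hp).symm).pow_right r
  obtain ⟨m, hm, rfl⟩ := ha
  obtain ⟨m', hm', rfl⟩ := hb
  rcases lt_trichotomy m' m with h | h | h
  · exact key m m' hm h
  · exact absurd (by rw [h]) hab
  · rw [← neg_sub]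
    exact (key m' m hm' h).neg

/-! ### Triangular sequences adapted to a family of submodules -/

/-- If `p v i` lies in the span of the later vectors, then the span of a final segment of `v`
consists of combinations of that segment with digits as coefficients. -/
theorem exists_digits_of_mem_span {p r : ℕ} (hp : p.Prime) {V : Type*} [AddCommGroup V]
    [Module (ZMod (p ^ r)) V] {k : ℕ} (v : Fin k → V)
    (hv : ∀ i, (p : ZMod (p ^ r)) • v i ∈ Submodule.span (ZMod (p ^ r)) (v '' Set.Ioi i))
    (S : Set (Fin k)) (hS : IsUpperSet S) (x : V)
    (hx : x ∈ Submodule.span (ZMod (p ^ r)) (v '' S)) :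
    ∃ a : Fin k → ZMod (p ^ r), (∀ j, a j ∈ digits p r) ∧ (∀ j, j ∉ S → a j = 0) ∧
      x = ∑ j, a j • v j := by
  induction k generalizing x with
  | zero =>
    have : v '' S = ∅ := by
      rw [Set.image_eq_empty]; ext j; exact j.elim0
    rw [this, Submodule.span_empty, Submodule.mem_bot] at hx
    exact ⟨0, fun j => j.elim0, fun j => j.elim0, by simp [hx]⟩
  | succ k ih =>
    have hIoi : ∀ i : Fin k, v '' Set.Ioi i.succ = (fun j : Fin k => v j.succ) '' Set.Ioi i := by
      intro i
      rw [← Fin.image_succ_Ioi, Set.image_image]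
    have hIoi0 : v '' Set.Ioi 0 = (fun j : Fin k => v j.succ) '' Set.univ := by
      ext y
      simp only [Set.mem_image, Set.mem_Ioi, Set.mem_univ, true_and]
      constructor
      · rintro ⟨j, hj, rfl⟩
        obtain ⟨i, rfl⟩ := Fin.exists_succ_eq.mpr hj.ne'
        exact ⟨i, rfl⟩
      · rintro ⟨j, rfl⟩
        exact ⟨j.succ, Fin.succ_pos j, rfl⟩
    have htail := ih (fun j => v j.succ) (fun i => by rw [← hIoi]; exact hv i.succ)
    by_cases h0 : (0 : Fin (k + 1)) ∈ S
    · have hSu : S = insert 0 (Set.Ioi 0) := by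
        ext j
        simp only [Set.mem_insert_iff, Set.mem_Ioi]
        exact ⟨fun _ => (Fin.zero_le j).eq_or_lt.imp Eq.symm id, fun _ => hS (Fin.zero_le j) h0⟩
      rw [hSu, Set.image_insert_eq, Submodule.mem_span_insert] at hx
      obtain ⟨c, z, hz, rfl⟩ := hx
      obtain ⟨a₀, ha₀, y, rfl⟩ := exists_digit_add_mul hp c
      have hz' := Submodule.add_mem _ (Submodule.smul_mem _ y (hv 0)) hz
      rw [hIoi0] at hz'
      obtain ⟨a, ha, -, h⟩ := htail Set.univ isUpperSet_univ _ hz'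
      refine ⟨Fin.cons a₀ a, fun j => ?_, fun j hj => absurd (hS (Fin.zero_le j) h0) hj, ?_⟩
      · refine Fin.cases ?_ (fun i => ?_) j
        · simpa using ha₀
        · simpa using ha i
      · rw [Fin.sum_univ_succ]
        simp only [Fin.cons_zero, Fin.cons_succ]
        rw [← h, add_smul, mul_smul, add_assoc]
    · have hSs : v '' S = (fun j : Fin k => v j.succ) '' (Fin.succ ⁻¹' S) := by
        ext y
        simp only [Set.mem_image, Set.mem_preimage]
        constructor
        · rintro ⟨j, hj, rfl⟩
          obtain ⟨i, rfl⟩ := Fin.exists_succ_eq.mpr (fun h => h0 (h ▸ hj))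
          exact ⟨i, hj, rfl⟩
        · rintro ⟨j, hj, rfl⟩
          exact ⟨j.succ, hj, rfl⟩
      rw [hSs] at hx
      obtain ⟨a, ha, ha', h⟩ := htail (Fin.succ ⁻¹' S)
        (fun i j hij hi => hS (Fin.succ_le_succ_iff.mpr hij) hi) x hx
      refine ⟨Fin.cons 0 a, fun j => ?_, fun j => ?_, ?_⟩
      · refine Fin.cases ?_ (fun i => ?_) j
        · simpa using zero_mem_digits hp r
        · simpa using ha i
      · refine Fin.cases ?_ (fun i hi => ?_) j
        · simp
        · simpa using ha' i hi
      · rw [Fin.sum_univ_succ]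
        simpa using h

/-- A sequence in which no vector lies in the span of the later ones admits no nontrivial relation
whose nonzero coefficients are units. -/
theorem eq_zero_of_sum_smul_eq_zero {R V : Type*} [CommRing R] [AddCommGroup V] [Module R V]
    {k : ℕ} {v : Fin k → V} (hv : ∀ i, v i ∉ Submodule.span R (v '' Set.Ioi i))
    {c : Fin k → R} (hc : ∀ i, c i ≠ 0 → IsUnit (c i)) (h : ∑ i, c i • v i = 0) (i : Fin k) :
    c i = 0 := by
  induction i using WellFoundedLT.induction with
  | _ i ih =>
    by_contra hi
    refine hv i ((Submodule.smul_mem_iff_of_isUnit _ (hc i hi)).mp ?_)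
    rw [← Finset.add_sum_erase _ _ (Finset.mem_univ i)] at h
    rw [eq_neg_of_add_eq_zero_left h]
    refine Submodule.neg_mem _ (Submodule.sum_mem _ fun j hj => ?_)
    rcases lt_or_gt_of_ne (Finset.ne_of_mem_erase hj) with hlt | hgt
    · rw [ih j hlt, zero_smul]
      exact Submodule.zero_mem _
    · exact Submodule.smul_mem _ _ (Submodule.subset_span ⟨j, hgt, rfl⟩)

/-- A sequence `v`, graded by `d`, that refines the family `L`: each `v i` lies in `L (d i)`, the
degrees decrease, `v i` is outside the span of the later vectors while `p v i` is inside, and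
every `L e` with `e` below some degree is spanned by the vectors of degree at most `e`. -/
structure IsAdaptedSequence {R V : Type*} [CommRing R] [AddCommGroup V] [Module R V] (p : ℕ)
    (L : ℕ → Submodule R V) {k : ℕ} (v : Fin k → V) (d : Fin k → ℕ) : Prop where
  antitone : Antitone d
  mem : ∀ i, v i ∈ L (d i)
  smul_mem : ∀ i, (p : R) • v i ∈ Submodule.span R (v '' Set.Ioi i)
  notMem : ∀ i, v i ∉ Submodule.span R (v '' Set.Ioi i)
  le_span : ∀ e, (∃ i, e < d i) → L e ≤ Submodule.span R (v '' {j | d j ≤ e})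

/-- An adapted sequence can be prolonged by a vector from the first `L e` that it does not span. -/
theorem IsAdaptedSequence.exists_cons {R V : Type*} [CommRing R] [AddCommGroup V] [Module R V]
    {p : ℕ} (hp : ∃ s : ℕ, (p : R) ^ s = 0) {L : ℕ → Submodule R V} {k : ℕ} {v : Fin k → V}
    {d : Fin k → ℕ} (h : IsAdaptedSequence p L v d)
    (hL : ∃ e, ¬ L e ≤ Submodule.span R (Set.range v)) :
    ∃ x e, x ∉ Submodule.span R (Set.range v) ∧
      IsAdaptedSequence p L (Fin.cons x v : Fin (k + 1) → V) (Fin.cons e d : Fin (k + 1) → ℕ) := by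
  classical
  set W := Submodule.span R (Set.range v) with hW
  let e := Nat.find hL
  have he : ¬ L e ≤ W := Nat.find_spec hL
  have hlt : ∀ e' < e, L e' ≤ W := fun e' h' => not_not.mp (Nat.find_min hL h')
  obtain ⟨y, hyL, hyW⟩ := SetLike.not_le_iff_exists.mp he
  have hs : ∃ s : ℕ, (p : R) ^ s • y ∈ W := by
    obtain ⟨s, hs⟩ := hp
    exact ⟨s, by rw [hs, zero_smul]; exact W.zero_mem⟩
  -- the last multiple `p ^ t y` outside the span
  obtain ⟨t, ht⟩ : ∃ t, Nat.find hs = t + 1 := by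
    refine Nat.exists_eq_succ_of_ne_zero fun h0 => hyW ?_
    have := Nat.find_spec hs
    rwa [h0, pow_zero, one_smul] at this
  have hx : (p : R) ^ t • y ∉ W := Nat.find_min hs (by omega)
  have hpx : (p : R) • (p : R) ^ t • y ∈ W := by
    rw [smul_smul, ← pow_succ', ← ht]
    exact Nat.find_spec hs
  have hde : ∀ i, d i ≤ e := by
    intro i
    by_contra hi
    exact he ((h.le_span e ⟨i, not_le.mp hi⟩).trans
      (Submodule.span_mono (Set.image_subset_range _ _)))
  set x := (p : R) ^ t • y with hxdef
  have hIoi0 : (Fin.cons x v : Fin (k + 1) → V) '' Set.Ioi 0 = Set.range v := by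
    ext y
    simp only [Set.mem_image, Set.mem_Ioi, Set.mem_range]
    constructor
    · rintro ⟨j, hj, rfl⟩
      obtain ⟨i, rfl⟩ := Fin.exists_succ_eq.mpr hj.ne'
      exact ⟨i, by simp⟩
    · rintro ⟨j, rfl⟩
      exact ⟨j.succ, Fin.succ_pos j, by simp⟩
  have hIoi : ∀ i : Fin k,
      (Fin.cons x v : Fin (k + 1) → V) '' Set.Ioi i.succ = v '' Set.Ioi i := by
    intro i
    rw [← Fin.image_succ_Ioi, Set.image_image]
    simp
  refine ⟨x, e, hx, ?_, ?_, ?_, ?_, ?_⟩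
  · intro i j
    refine Fin.cases ?_ (fun i => ?_) i <;> refine Fin.cases ?_ (fun j => ?_) j
    · simp
    · intro _; simpa using hde j
    · intro hij; simp at hij
    · intro hij
      simpa using h.antitone (Fin.succ_le_succ_iff.mp hij)
  · intro i
    refine Fin.cases ?_ (fun i => ?_) i
    · simpa using (L e).smul_mem _ hyL
    · simpa using h.mem i
  · intro i
    refine Fin.cases ?_ (fun i => ?_) i
    · rw [hIoi0]; simpa using hpx
    · rw [hIoi]; simpa using h.smul_mem i
  · intro i
    refine Fin.cases ?_ (fun i => ?_) i
    · rw [hIoi0]; simpa using hx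
    · rw [hIoi]; simpa using h.notMem i
  · intro e' he'
    have hsub : v '' {j | d j ≤ e'} ⊆ (Fin.cons x v : Fin (k + 1) → V) ''
        {j | (Fin.cons e d : Fin (k + 1) → ℕ) j ≤ e'} := by
      rintro _ ⟨j, hj, rfl⟩
      exact ⟨j.succ, by simpa using hj, by simp⟩
    refine le_trans ?_ (Submodule.span_mono hsub)
    by_cases hi : ∃ i, e' < d i
    · exact h.le_span e' hi
    · push Not at hi
      have : v '' {j | d j ≤ e'} = Set.range v := by
        rw [Set.eq_univ_of_forall (s := {j | d j ≤ e'}) hi, Set.image_univ]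
      rw [this]
      apply hlt
      obtain ⟨i, hi'⟩ := he'
      refine Fin.cases (fun h => ?_) (fun i h => ?_) i hi'
      · simpa using h
      · exact absurd (hi i) (not_le.mpr (by simpa using h))

/-- Over a ring in which `p` is nilpotent, every family of submodules of a Noetherian module has
an adapted sequence that spans all of its members. The spans of its final segments filter the sum of
the family, with nonzero cyclic factors killed by `p`; over `ℤ / p ^ r` they form a composition
series. -/
theorem exists_isAdaptedSequence {R V : Type*} [CommRing R] [AddCommGroup V] [Module R V]
    [IsNoetherian R V] {p : ℕ} (hp : ∃ s : ℕ, (p : R) ^ s = 0) (L : ℕ → Submodule R V) :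
    ∃ (k : ℕ) (v : Fin k → V) (d : Fin k → ℕ), IsAdaptedSequence p L v d ∧
      ∀ e, L e ≤ Submodule.span R (v '' {j | d j ≤ e}) := by
  suffices H : ∀ (W : Submodule R V) (k : ℕ) (v : Fin k → V) (d : Fin k → ℕ),
      IsAdaptedSequence p L v d → Submodule.span R (Set.range v) = W →
      ∃ (k : ℕ) (v : Fin k → V) (d : Fin k → ℕ), IsAdaptedSequence p L v d ∧
        ∀ e, L e ≤ Submodule.span R (v '' {j | d j ≤ e}) by
    refine H _ 0 Fin.elim0 Fin.elim0 ⟨fun i => i.elim0, fun i => i.elim0, fun i => i.elim0,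
      fun i => i.elim0, fun e ⟨i, _⟩ => i.elim0⟩ rfl
  intro W
  induction W using WellFoundedGT.induction with
  | _ W ih =>
    intro k v d h hW
    by_cases hL : ∃ e, ¬ L e ≤ Submodule.span R (Set.range v)
    · obtain ⟨x, e, hx, hcons⟩ := h.exists_cons hp hL
      refine ih _ ?_ _ _ _ hcons rfl
      rw [← hW, Fin.range_cons]
      refine lt_of_le_of_ne (Submodule.span_mono (Set.subset_insert _ _)) fun heq => hx ?_
      rw [heq]
      exact Submodule.subset_span (Set.mem_insert _ _)
    · push Not at hL
      refine ⟨k, v, d, h, fun e => ?_⟩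
      by_cases hi : ∃ i, e < d i
      · exact h.le_span e hi
      · push Not at hi
        rw [Set.eq_univ_of_forall (s := {j | d j ≤ e}) hi, Set.image_univ]
        exact hL e

/-! ### Reduced `p`-bases of polynomial modules -/

/-- The vectors of coefficients at `D ^ e` of the elements of `M` of degree at most `e`. -/
def leadingCoeffs {R : Type*} [CommRing R] {n : ℕ} (M : Submodule R[X] (Fin n → R[X])) (e : ℕ) :
    Submodule R (Fin n → R) where
  carrier := {x | ∃ m ∈ M, (∀ j, (m j).natDegree ≤ e) ∧ ∀ j, (m j).coeff e = x j}
  add_mem' := by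
    rintro x y ⟨m, hm, hme, hmx⟩ ⟨m', hm', hme', hmy⟩
    exact ⟨m + m', M.add_mem hm hm', fun j => natDegree_add_le_of_degree_le (hme j) (hme' j),
      fun j => by simp [hmx, hmy]⟩
  zero_mem' := ⟨0, M.zero_mem, by simp, by simp⟩
  smul_mem' := by
    rintro c x ⟨m, hm, hme, hmx⟩
    refine ⟨(C c : R[X]) • m, M.smul_mem _ hm, fun j => ?_, fun j => by simp [hmx]⟩
    exact (natDegree_C_mul_le _ _).trans (hme j)

/-- Lifts `g i ∈ M` of an adapted sequence `v` for the leading coefficients of `M`: the degree of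
`g i` is at most `d i`, and `v i` is its coefficient there. -/
structure IsLeadingLift {R : Type*} [CommRing R] (p : ℕ) {n k : ℕ}
    (M : Submodule R[X] (Fin n → R[X])) (g : Fin k → Fin n → R[X]) (v : Fin k → Fin n → R)
    (d : Fin k → ℕ) : Prop where
  adapted : IsAdaptedSequence p (leadingCoeffs M) v d
  le_span : ∀ e, leadingCoeffs M e ≤ Submodule.span R (v '' {j | d j ≤ e})
  mem : ∀ i, g i ∈ M
  natDegree_le : ∀ i j, (g i j).natDegree ≤ d i
  coeff_eq : ∀ i j, (g i j).coeff (d i) = v i j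

theorem exists_isLeadingLift {R : Type*} [CommRing R] [IsNoetherianRing R] {p : ℕ}
    (hp : ∃ s : ℕ, (p : R) ^ s = 0) {n : ℕ} (M : Submodule R[X] (Fin n → R[X])) :
    ∃ (k : ℕ) (g : Fin k → Fin n → R[X]) (v : Fin k → Fin n → R) (d : Fin k → ℕ),
      IsLeadingLift p M g v d := by
  obtain ⟨k, v, d, h, hspan⟩ := exists_isAdaptedSequence hp (leadingCoeffs M)
  choose g hg hdeg hcoeff using h.mem
  exact ⟨k, g, v, d, h, hspan, hg, hdeg, hcoeff⟩

section

variable {R : Type*} [CommRing R]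

theorem natDegree_mul_le_and_coeff_mul {a b : R[X]} {d N : ℕ}
    (ha : ∀ e, N < e + d → a.coeff e = 0) (hb : b.natDegree ≤ d) :
    (a * b).natDegree ≤ N ∧
      (a * b).coeff N = (if d ≤ N then a.coeff (N - d) else 0) * b.coeff d := by
  by_cases hd : d ≤ N
  · have ha' : a.natDegree ≤ N - d :=
      natDegree_le_iff_coeff_eq_zero.mpr fun e he => ha e (by omega)
    refine ⟨(natDegree_mul_le_of_le ha' hb).trans (by omega), ?_⟩
    rw [if_pos hd, ← coeff_mul_add_eq_of_natDegree_le ha' hb, Nat.sub_add_cancel hd]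
  · have : a = 0 := by
      ext e
      simpa using ha e (by omega)
    simp [this, hd]

variable {p n k : ℕ} {M : Submodule R[X] (Fin n → R[X])} {g : Fin k → Fin n → R[X]}
  {v : Fin k → Fin n → R} {d : Fin k → ℕ}

/-- Predictable degree: the top coefficient of a combination of the `g i` is the corresponding
combination of their leading coefficient vectors. -/
theorem IsLeadingLift.natDegree_sum_le_and_coeff_sum (h : IsLeadingLift p M g v d) {N : ℕ}
    {a : Fin k → R[X]} (ha : ∀ i e, N < e + d i → (a i).coeff e = 0) (j : Fin n) :
    ((∑ i, a i • g i) j).natDegree ≤ N ∧ ((∑ i, a i • g i) j).coeff N =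
      (∑ i, (if d i ≤ N then (a i).coeff (N - d i) else 0) • v i) j := by
  have key := fun i => natDegree_mul_le_and_coeff_mul (ha i) (h.natDegree_le i j)
  simp only [Finset.sum_apply, Pi.smul_apply, smul_eq_mul]
  refine ⟨natDegree_sum_le_of_forall_le _ _ fun i _ => (key i).1, ?_⟩
  rw [finsetSum_coeff]
  exact Finset.sum_congr rfl fun i _ => by rw [(key i).2, h.coeff_eq]

/-- No nontrivial combination of the `g i` vanishes, if the nonzero coefficients of its polynomials
are units. -/
theorem IsLeadingLift.eq_zero_of_sum_eq_zero (h : IsLeadingLift p M g v d) {a : Fin k → R[X]}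
    (ha : ∀ i e, (a i).coeff e ≠ 0 → IsUnit ((a i).coeff e)) (h0 : ∑ i, a i • g i = 0) :
    a = 0 := by
  have step : ∀ N, (∀ i e, N < e + d i → (a i).coeff e = 0) →
      ∀ i e, N = e + d i → (a i).coeff e = 0 := by
    intro N hN i e hie
    have hv : ∑ i, (if d i ≤ N then (a i).coeff (N - d i) else 0) • v i = 0 := by
      funext j
      rw [← (h.natDegree_sum_le_and_coeff_sum hN j).2, h0]
      simp
    have := eq_zero_of_sum_smul_eq_zero h.adapted.notMem (fun i => by
      split_ifs with hi
      · exact ha i _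
      · simp) hv i
    have hiN : d i ≤ N := by omega
    rwa [if_pos hiN, hie, Nat.add_sub_cancel] at this
  obtain ⟨B, hB⟩ : ∃ B, ∀ i e, B < e + d i → (a i).coeff e = 0 := by
    refine ⟨∑ i, ((a i).natDegree + d i), fun i e he => coeff_eq_zero_of_natDegree_lt ?_⟩
    have := Finset.single_le_sum (f := fun i => (a i).natDegree + d i)
      (fun _ _ => Nat.zero_le _) (Finset.mem_univ i)
    omega
  have all : ∀ t i e, B < e + d i + t → (a i).coeff e = 0 := by
    intro t
    induction t with
    | zero => exact hB
    | succ t ih =>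
      intro i e he
      by_cases het : B < e + d i + t
      · exact ih i e het
      · exact step (e + d i) (fun i' e' he' => ih i' e' (by omega)) i e rfl
  funext i
  ext e
  simpa using all (B + 1) i e (by omega)

end

section

variable {p r n k : ℕ} {M : Submodule (ZMod (p ^ r))[X] (Fin n → (ZMod (p ^ r))[X])}
  {g : Fin k → Fin n → (ZMod (p ^ r))[X]} {v : Fin k → Fin n → ZMod (p ^ r)} {d : Fin k → ℕ}

/-- Combinations with coefficients in `𝒜[D]` are unique. -/
theorem IsLeadingLift.digits_unique (hp : p.Prime) (h : IsLeadingLift p M g v d)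
    {a b : Fin k → (ZMod (p ^ r))[X]} (ha : ∀ i, a i ∈ digitPolynomials p r)
    (hb : ∀ i, b i ∈ digitPolynomials p r) (hab : ∑ i, a i • g i = ∑ i, b i • g i) : a = b := by
  rw [← sub_eq_zero]
  refine h.eq_zero_of_sum_eq_zero (fun i e hne => ?_) ?_
  · rw [Pi.sub_apply, coeff_sub] at hne ⊢
    exact isUnit_sub_of_digits hp (ha i e) (hb i e) (sub_ne_zero.mp hne)
  · simp [sub_smul, hab]

/-- One step of the division: a digit combination of the leading coefficient vectors that equals the
coefficient of `m` at `D ^ N` allows lowering the degree of `m` below `N`. -/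
theorem IsLeadingLift.sub_sum_monomial (h : IsLeadingLift p M g v d) {N : ℕ}
    {m : Fin n → (ZMod (p ^ r))[X]} (hm : m ∈ M) (hmN : ∀ j, (m j).natDegree ≤ N)
    {c : Fin k → ZMod (p ^ r)} (hc : ∀ i, N < d i → c i = 0)
    (hmc : ∀ j, (m j).coeff N = (∑ i, c i • v i) j) :
    m - ∑ i, monomial (N - d i) (c i) • g i ∈ M ∧
      ∀ j e, N ≤ e → ((m - ∑ i, monomial (N - d i) (c i) • g i) j).coeff e = 0 := by
  refine ⟨M.sub_mem hm (Submodule.sum_mem _ fun i _ => M.smul_mem _ (h.mem i)), ?_⟩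
  intro j e he
  have key := h.natDegree_sum_le_and_coeff_sum (N := N) (a := fun i => monomial (N - d i) (c i))
    (fun i e he => by
      rw [coeff_monomial]
      split_ifs with hie
      · exact hc i (by omega)
      · rfl) j
  rw [Pi.sub_apply, coeff_sub]
  rcases he.eq_or_lt with rfl | hlt
  · rw [key.2, hmc, sub_eq_zero]
    refine congrFun (Finset.sum_congr rfl fun i _ => ?_) j
    split_ifs with hi
    · simp
    · rw [hc i (by omega)]
  · rw [coeff_eq_zero_of_natDegree_lt ((hmN j).trans_lt hlt),
      coeff_eq_zero_of_natDegree_lt (key.1.trans_lt hlt), sub_zero]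

theorem add_monomial_mem_digitPolynomials {a : (ZMod (p ^ r))[X]} (ha : a ∈ digitPolynomials p r)
    {c : ZMod (p ^ r)} (hc : c ∈ digits p r) {e : ℕ} (hae : a.coeff e = 0) :
    a + monomial e c ∈ digitPolynomials p r := by
  intro i
  rw [coeff_add, coeff_monomial]
  split_ifs with h
  · rw [← h, hae, zero_add]; exact hc
  · rw [add_zero]; exact ha i

/-- Division with remainder by leading coefficients: an element of `M` of degree below `N` is a
combination of the `g i` with coefficients in `𝒜[D]`, all of whose terms have degree below `N`. -/
theorem IsLeadingLift.exists_digits (hp : p.Prime) (h : IsLeadingLift p M g v d) (N : ℕ)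
    (m : Fin n → (ZMod (p ^ r))[X]) (hm : m ∈ M) (hmN : ∀ j e, N ≤ e → (m j).coeff e = 0) :
    ∃ a : Fin k → (ZMod (p ^ r))[X], (∀ i, a i ∈ digitPolynomials p r) ∧
      (∀ i e, N ≤ e + d i → (a i).coeff e = 0) ∧ m = ∑ i, a i • g i := by
  induction N generalizing m with
  | zero =>
    refine ⟨0, fun i e => by simpa using zero_mem_digits hp r, by simp, ?_⟩
    funext j
    ext e
    simpa using hmN j e (Nat.zero_le _)
  | succ N ih =>
    have hdeg : ∀ j, (m j).natDegree ≤ N := fun j =>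
      natDegree_le_iff_coeff_eq_zero.mpr fun e he => hmN j e he
    obtain ⟨c, hc, hc0, hmc⟩ := exists_digits_of_mem_span hp v h.adapted.smul_mem {j | d j ≤ N}
      (fun i j hij hi => (h.adapted.antitone hij).trans hi) (fun j => (m j).coeff N)
      (h.le_span N ⟨m, hm, hdeg, fun j => rfl⟩)
    obtain ⟨hm', hm'N⟩ := h.sub_sum_monomial hm hdeg (fun i hi => hc0 i (not_le.mpr hi))
      (fun j => congrFun hmc j)
    obtain ⟨a, ha, haN, hma⟩ := ih _ hm' hm'N
    refine ⟨fun i => a i + monomial (N - d i) (c i), fun i =>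
      add_monomial_mem_digitPolynomials (ha i) (hc i) (haN i _ (by omega)), fun i e he => ?_, ?_⟩
    · rw [coeff_add, haN i e (by omega), coeff_monomial, zero_add]
      split_ifs with hie
      · exact hc0 i (by simp only [Set.mem_ofPred_eq]; omega)
      · rfl
    · simp only [add_smul, Finset.sum_add_distrib, ← hma, sub_add_cancel]

theorem IsLeadingLift.exists_digits_of_mem (hp : p.Prime) (h : IsLeadingLift p M g v d)
    {m : Fin n → (ZMod (p ^ r))[X]} (hm : m ∈ M) :
    ∃ a : Fin k → (ZMod (p ^ r))[X], (∀ i, a i ∈ digitPolynomials p r) ∧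
      m = ∑ i, a i • g i := by
  obtain ⟨a, ha, -, hma⟩ := h.exists_digits hp (∑ j, (m j).natDegree + 1) m hm fun j e he => by
    have := Finset.single_le_sum (f := fun j => (m j).natDegree)
      (fun _ _ => Nat.zero_le _) (Finset.mem_univ j)
    exact coeff_eq_zero_of_natDegree_lt (by omega)
  exact ⟨a, ha, hma⟩

theorem IsLeadingLift.isPGeneratorSequence (hp : p.Prime) (h : IsLeadingLift p M g v d) :
    IsPGeneratorSequence p r g := by
  intro i
  have hdeg : ∀ j, (((p : (ZMod (p ^ r))[X]) • g i) j).natDegree ≤ d i := fun j => by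
    rw [Pi.smul_apply, smul_eq_mul, ← C_eq_natCast]
    exact (natDegree_C_mul_le _ _).trans (h.natDegree_le i j)
  obtain ⟨c, hc, hc0, hmc⟩ := exists_digits_of_mem_span hp v h.adapted.smul_mem (Set.Ioi i)
    (isUpperSet_Ioi i) _ (h.adapted.smul_mem i)
  obtain ⟨hm', hm'N⟩ := h.sub_sum_monomial (M.smul_mem _ (h.mem i)) hdeg
    (fun j hj => hc0 j fun hij => (h.adapted.antitone hij.le).not_gt hj)
    (fun j => by
      rw [← congrFun hmc j, Pi.smul_apply, Pi.smul_apply, smul_eq_mul, ← C_eq_natCast,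
        coeff_C_mul, h.coeff_eq]
      rfl)
  obtain ⟨a, ha, haN, hma⟩ := h.exists_digits hp _ _ hm' hm'N
  refine ⟨fun j => a j + monomial (d i - d j) (c j), fun j =>
    add_monomial_mem_digitPolynomials (ha j) (hc j) (haN j _ (by omega)), ?_⟩
  rw [sub_eq_iff_eq_add, ← Finset.sum_add_distrib] at hma
  rw [hma]
  symm
  simp only [← add_smul]
  refine Finset.sum_subset (Finset.subset_univ _) fun j _ hj => ?_
  -- the vectors up to the `i`-th have degree at least `d i`, so they do not occur
  have hji : j ≤ i := not_lt.mp (by simpa using hj)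
  have haj : a j = 0 := by
    ext e
    simpa using haN j e ((h.adapted.antitone hji).trans (Nat.le_add_left _ _))
  rw [haj, hc0 j (by simpa using hji)]
  simp

theorem IsLeadingLift.pLinearIndependent (hp : p.Prime) (h : IsLeadingLift p M g v d) :
    PLinearIndependent p r g := by
  intro a ha h0 i
  have := h.digits_unique hp ha (b := 0) (fun i e => by simpa using zero_mem_digits hp r)
    (by simpa using h0)
  rw [this, Pi.zero_apply]

theorem IsLeadingLift.rowDegree_eq (h : IsLeadingLift p M g v d) (i : Fin k) :
    rowDegree (g i) = d i := by
  refine le_antisymm (Finset.sup_le fun j _ => h.natDegree_le i j) ?_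
  obtain ⟨j, hj⟩ : ∃ j, v i j ≠ 0 := by
    by_contra! hv
    refine h.adapted.notMem i ?_
    rw [show v i = 0 from funext hv]
    exact Submodule.zero_mem _
  rw [← h.coeff_eq] at hj
  exact (le_natDegree_of_ne_zero hj).trans
    (Finset.le_sup (f := fun j => (g i j).natDegree) (Finset.mem_univ j))

theorem IsLeadingLift.pLinearIndependentConst_leadingRowCoeff (hp : p.Prime)
    (h : IsLeadingLift p M g v d) :
    PLinearIndependentConst p r (leadingRowCoeff (Matrix.of g)).row := by
  have hrow : (leadingRowCoeff (Matrix.of g)).row = v := by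
    funext i j
    change (g i j).coeff (rowDegree (g i)) = v i j
    rw [h.rowDegree_eq, h.coeff_eq]
  rw [hrow]
  intro a ha h0 i
  refine eq_zero_of_sum_smul_eq_zero h.adapted.notMem (fun i hi => ?_) h0 i
  simpa using isUnit_sub_of_digits hp (ha i) (zero_mem_digits hp r) hi

end

open Matrix

/-! ### Vectors of polynomials, power series and Laurent series -/

section

variable {R : Type*} [CommRing R] {k n : ℕ}

/-- A vector of power series, regarded as a vector of Laurent series. -/
noncomputable def coeVec (w : Fin n → PowerSeries R) : Fin n → LaurentSeries R :=
  HahnSeries.ofPowerSeries ℤ R ∘ w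

/-- A vector of polynomials, regarded as a vector of power series. -/
noncomputable def psVec (m : Fin n → R[X]) : Fin n → PowerSeries R :=
  coeToPowerSeries.ringHom ∘ m

/-- A polynomial matrix, regarded as a matrix over the ring of power series. -/
noncomputable def psMatrix (G : Matrix (Fin k) (Fin n) R[X]) : Matrix (Fin k) (Fin n) (PowerSeries R) :=
  G.map coeToPowerSeries.ringHom

/-- The monomial `D ^ N` as a Laurent series. -/
noncomputable def monomialD (R : Type*) [CommRing R] (N : ℤ) : LaurentSeries R := HahnSeries.single N 1

theorem coeff_psVec (m : Fin n → R[X]) (j : Fin n) (t : ℕ) :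
    PowerSeries.coeff t (psVec m j) = (m j).coeff t := by
  simp [psVec]

theorem psVec_vecMul (u : Fin k → R[X]) (G : Matrix (Fin k) (Fin n) R[X]) :
    psVec (u ᵥ* G) = psVec u ᵥ* psMatrix G :=
  funext fun j => RingHom.map_vecMul _ G u j

theorem coeVec_vecMul (u : Fin k → PowerSeries R) (G : Matrix (Fin k) (Fin n) R[X]) :
    coeVec (u ᵥ* psMatrix G) = coeVec u ᵥ* laurentMatrix G :=
  funext fun j => RingHom.map_vecMul _ (psMatrix G) u j

theorem coeVec_injective : Function.Injective (coeVec : (Fin n → PowerSeries R) → _) :=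
  fun _ _ h => funext fun j => HahnSeries.ofPowerSeries_injective (congrFun h j)

theorem coeVec_X_pow_smul (N : ℕ) (w : Fin n → PowerSeries R) :
    coeVec ((PowerSeries.X ^ N : PowerSeries R) • w) = monomialD R N • coeVec w := by
  funext j
  simp only [coeVec, monomialD, Function.comp_apply, Pi.smul_apply, smul_eq_mul, map_mul,
    HahnSeries.ofPowerSeries_X_pow]

theorem psVec_X_pow_smul (N : ℕ) (m : Fin n → R[X]) :
    psVec ((X ^ N : R[X]) • m) = (PowerSeries.X ^ N : PowerSeries R) • psVec m := by
  funext j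
  simp [psVec]

theorem monomialD_mul (N N' : ℤ) : monomialD R N * monomialD R N' = monomialD R (N + N') := by
  simp [monomialD]

theorem monomialD_smul_smul (N N' : ℤ) (w : Fin n → LaurentSeries R) :
    monomialD R N • monomialD R N' • w = monomialD R (N + N') • w := by
  rw [smul_smul, monomialD_mul]

theorem monomialD_zero_smul (w : Fin n → LaurentSeries R) : monomialD R 0 • w = w := by
  rw [show monomialD R 0 = 1 from rfl, one_smul]

theorem coeff_monomialD_smul (N : ℤ) (w : Fin n → LaurentSeries R) (j : Fin n) (e : ℤ) :
    ((monomialD R N • w) j).coeff e = (w j).coeff (e - N) := by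
  have := HahnSeries.coeff_single_mul_add (r := (1 : R)) (x := w j) (a := e - N) (b := N)
  rw [sub_add_cancel, one_mul] at this
  exact this

theorem monomialD_smul_mem_iff {C : Submodule (LaurentSeries R) (Fin n → LaurentSeries R)}
    (N : ℤ) {w : Fin n → LaurentSeries R} : monomialD R N • w ∈ C ↔ w ∈ C := by
  refine ⟨fun h => ?_, fun h => C.smul_mem _ h⟩
  have := C.smul_mem (monomialD R (-N)) h
  rwa [monomialD_smul_smul, neg_add_cancel, monomialD_zero_smul] at this

/-- A common power of `D` clears the negative powers of finitely many Laurent series. -/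
theorem exists_monomialD_smul_eq_coeVec (u : Fin k → LaurentSeries R) :
    ∃ (N : ℕ) (U : Fin k → PowerSeries R), monomialD R N • u = coeVec U ∧
      ∀ i t, PowerSeries.coeff t (U i) = (u i).coeff (t - N) := by
  let N : ℕ := ∑ i, (u i).order.natAbs
  refine ⟨N, fun i => PowerSeries.mk fun t => (u i).coeff (t - N), ?_, fun i t => by simp⟩
  funext i
  ext e
  rw [coeff_monomialD_smul, coeVec, Function.comp_apply, PowerSeries.coeff_coe]
  split_ifs with he
  · refine HahnSeries.coeff_eq_zero_of_lt_order ?_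
    have := Finset.single_le_sum (f := fun i => (u i).order.natAbs)
      (fun _ _ => Nat.zero_le _) (Finset.mem_univ i)
    have : (u i).order.natAbs ≤ N := this
    omega
  · rw [PowerSeries.coeff_mk]
    congr 1
    omega

/-- A vector of Laurent series has finite weight exactly when some `D ^ N` turns it into a vector of
polynomials. -/
theorem weight_lt_top_iff (w : Fin n → LaurentSeries R) :
    weight w < ⊤ ↔ ∃ (N : ℕ) (m : Fin n → R[X]), monomialD R N • w = coeVec (psVec m) := by
  have hfin : weight w < ⊤ ↔ ∀ j, {e : ℤ | (w j).coeff e ≠ 0}.Finite := by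
    simp only [weight, ENat.sum_lt_top, Finset.mem_univ, true_imp_iff, Set.encard_lt_top_iff]
  rw [hfin]
  constructor
  · intro h
    obtain ⟨N, U, hU, hcoeff⟩ := exists_monomialD_smul_eq_coeVec w
    have hB : ∀ j, ∃ m : R[X], (m : PowerSeries R) = U j := by
      intro j
      have hfin : {t : ℕ | PowerSeries.coeff t (U j) ≠ 0}.Finite := by
        refine Set.Finite.subset ((h j).preimage (f := fun t : ℕ => (t : ℤ) - N)
          fun a _ b _ hab => by simpa using hab) fun t ht => ?_
        simpa [hcoeff] using ht
      obtain ⟨B, hB⟩ := hfin.bddAbove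
      refine ⟨PowerSeries.trunc (B + 1) (U j), ?_⟩
      ext t
      rw [Polynomial.coeff_coe, PowerSeries.coeff_trunc]
      split_ifs with ht
      · rfl
      · by_contra hne
        have := hB (Ne.symm hne)
        omega
    choose m hm using hB
    exact ⟨N, m, by rw [hU]; exact congrArg coeVec (funext fun j => (hm j).symm)⟩
  · rintro ⟨N, m, h⟩ j
    refine ((m j).support.finite_toSet.image fun t : ℕ => (t : ℤ) - N).subset fun e he => ?_
    have := coeff_monomialD_smul (N : ℤ) w j (e + N)
    rw [h, add_sub_cancel_right, coeVec, Function.comp_apply, PowerSeries.coeff_coe] at this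
    have he' : (w j).coeff e ≠ 0 := he
    rw [← this] at he'
    split_ifs at he' with hlt
    · exact absurd rfl he'
    · rw [coeff_psVec] at he'
      exact ⟨(e + N).natAbs, by simpa using he', by simp only; omega⟩

theorem weight_monomialD_smul_lt_top {w : Fin n → LaurentSeries R} (hw : weight w < ⊤) (N : ℕ) :
    weight (monomialD R N • w) < ⊤ := by
  obtain ⟨N', m, h⟩ := (weight_lt_top_iff w).mp hw
  refine (weight_lt_top_iff _).mpr ⟨N', (X ^ N : R[X]) • m, ?_⟩
  rw [monomialD_smul_smul, add_comm, ← monomialD_smul_smul, h, psVec_X_pow_smul,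
    coeVec_X_pow_smul]

theorem eq_X_smul_shift_add_const (U : Fin k → PowerSeries R) :
    U = (PowerSeries.X : PowerSeries R) •
        (fun i => PowerSeries.mk fun t => PowerSeries.coeff (t + 1) (U i)) +
      psVec (fun i => C (PowerSeries.constantCoeff (U i))) := by
  funext i
  simpa [psVec] using PowerSeries.eq_X_mul_shift_add_const (U i)

theorem constantCoeff_vecMul_psMatrix (U : Fin k → PowerSeries R)
    (G : Matrix (Fin k) (Fin n) R[X]) (j : Fin n) :
    PowerSeries.constantCoeff ((U ᵥ* psMatrix G) j) =
      ∑ i, PowerSeries.constantCoeff (U i) * (G i j).coeff 0 := by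
  simp [psMatrix, vecMul, dotProduct]

/-! ### The polynomial vectors of a code -/

/-- The `R[D]`-module `C ∩ R[D] ^ n` of polynomial vectors of `C`. -/
def polynomialPart (C : Submodule (LaurentSeries R) (Fin n → LaurentSeries R)) :
    Submodule R[X] (Fin n → R[X]) where
  carrier := {m | coeVec (psVec m) ∈ C}
  add_mem' {a b} ha hb := by
    have : coeVec (psVec (a + b)) = coeVec (psVec a) + coeVec (psVec b) := by
      funext j
      simp [coeVec, psVec]
    change coeVec (psVec (a + b)) ∈ C
    rw [this]
    exact C.add_mem ha hb
  zero_mem' := by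
    have : coeVec (psVec (0 : Fin n → R[X])) = 0 := by
      funext j
      simp [coeVec, psVec]
    change coeVec (psVec 0) ∈ C
    rw [this]
    exact C.zero_mem
  smul_mem' c m hm := by
    have : coeVec (psVec (c • m)) = toLaurent R c • coeVec (psVec m) := by
      funext j
      simp [coeVec, psVec, toLaurent]
    change coeVec (psVec (c • m)) ∈ C
    rw [this]
    exact C.smul_mem _ hm

theorem mem_polynomialPart {C : Submodule (LaurentSeries R) (Fin n → LaurentSeries R)}
    {m : Fin n → R[X]} : m ∈ polynomialPart C ↔ coeVec (psVec m) ∈ C := Iff.rfl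

theorem X_pow_smul_mem_polynomialPart_iff
    {C : Submodule (LaurentSeries R) (Fin n → LaurentSeries R)} {m : Fin n → R[X]} (N : ℕ) :
    (X ^ N : R[X]) • m ∈ polynomialPart C ↔ m ∈ polynomialPart C := by
  rw [mem_polynomialPart, mem_polynomialPart, psVec_X_pow_smul, coeVec_X_pow_smul,
    monomialD_smul_mem_iff]

theorem vecMul_laurentMatrix_mem {C : Submodule (LaurentSeries R) (Fin n → LaurentSeries R)}
    {G : Matrix (Fin k) (Fin n) R[X]} (hG : ∀ i, G i ∈ polynomialPart C)
    (u : Fin k → LaurentSeries R) : u ᵥ* laurentMatrix G ∈ C := by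
  rw [vecMul_eq_sum]
  exact Submodule.sum_mem _ fun i _ => C.smul_mem _ (hG i)

/-- If a vector of `C` has no negative powers of `D`, then its constant term is that of a polynomial
vector of `C`. -/
theorem exists_mem_polynomialPart_coeff_zero {l : ℕ}
    {C : Submodule (LaurentSeries R) (Fin n → LaurentSeries R)}
    {G : Matrix (Fin l) (Fin n) R[X]} (hG : IsGeneratorMatrix G C) {c : Fin n → PowerSeries R}
    (hc : coeVec c ∈ C) :
    ∃ m ∈ polynomialPart C, ∀ j, (m j).coeff 0 = PowerSeries.constantCoeff (c j) := by
  obtain ⟨f, hf⟩ : ∃ f, f ᵥ* laurentMatrix G = coeVec c := by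
    rw [hG] at hc
    exact hc
  obtain ⟨N, F, hF, -⟩ := exists_monomialD_smul_eq_coeVec f
  -- truncating `D ^ N f` beyond `D ^ N` changes `D ^ N c` only beyond `D ^ N`
  let P : Fin l → R[X] := fun i => PowerSeries.trunc (N + 1) (F i)
  let F' : Fin l → PowerSeries R := fun i =>
    PowerSeries.mk fun t => PowerSeries.coeff (t + (N + 1)) (F i)
  have hFP : F = (PowerSeries.X ^ (N + 1) : PowerSeries R) • F' + psVec P :=
    funext fun i => PowerSeries.eq_X_pow_mul_shift_add_trunc (N + 1) (F i)
  have hFG : F ᵥ* psMatrix G = (PowerSeries.X ^ N : PowerSeries R) • c := by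
    apply coeVec_injective
    rw [coeVec_vecMul, ← hF, smul_vecMul, hf, coeVec_X_pow_smul]
  have hPG : psVec (P ᵥ* G) = (PowerSeries.X ^ N : PowerSeries R) •
      (c - (PowerSeries.X : PowerSeries R) • (F' ᵥ* psMatrix G)) := by
    rw [psVec_vecMul, smul_sub, smul_smul, ← pow_succ, ← hFG, ← smul_vecMul, ← sub_vecMul]
    congr 1
    exact (sub_eq_of_eq_add' hFP).symm
  have hcoeff : ∀ j t, ((P ᵥ* G) j).coeff t = PowerSeries.coeff t (PowerSeries.X ^ N *
      (c j - PowerSeries.X * (F' ᵥ* psMatrix G) j)) := fun j t => by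
    rw [← coeff_psVec, hPG]
    rfl
  have hdvd : ∀ j, ∃ q : R[X], (P ᵥ* G) j = X ^ N * q := fun j =>
    X_pow_dvd_iff.mpr fun t ht => by
      rw [hcoeff, PowerSeries.coeff_X_pow_mul', if_neg (by omega)]
  choose m hm using hdvd
  refine ⟨m, ?_, fun j => ?_⟩
  · rw [← X_pow_smul_mem_polynomialPart_iff N, ← show P ᵥ* G = (X ^ N : R[X]) • m from funext hm,
      mem_polynomialPart, psVec_vecMul, coeVec_vecMul, hG]
    exact ⟨_, rfl⟩
  · have := hcoeff j N
    rw [hm, Polynomial.coeff_X_pow_mul', if_pos le_rfl, PowerSeries.coeff_X_pow_mul',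
      if_pos le_rfl, Nat.sub_self] at this
    rw [this]
    simp

end

/-! ### Digit expansions along a reduced `p`-basis -/

section

variable {p r n k : ℕ}
  {C : Submodule (LaurentSeries (ZMod (p ^ r))) (Fin n → LaurentSeries (ZMod (p ^ r)))}
  {G : Matrix (Fin k) (Fin n) (ZMod (p ^ r))[X]} {v : Fin k → Fin n → ZMod (p ^ r)} {d : Fin k → ℕ}

/-- The constant terms of the `g i` have unique digit combinations: the polynomial part of a code is
saturated with respect to `D`, so a relation between constant terms comes from one in the module. -/
theorem IsLeadingLift.eq_of_sum_mul_coeff_zero_eq (hp : p.Prime)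
    (h : IsLeadingLift p (polynomialPart C) G v d) {a b : Fin k → ZMod (p ^ r)}
    (ha : ∀ i, a i ∈ digits p r) (hb : ∀ i, b i ∈ digits p r)
    (hab : ∀ j, ∑ i, a i * (G i j).coeff 0 = ∑ i, b i * (G i j).coeff 0) : a = b := by
  -- the difference of the two combinations is divisible by `D` in the module
  have hX : ∀ j, ∃ q, (∑ i, (Polynomial.C (a i) - Polynomial.C (b i)) • G i) j = X * q := fun j =>
    X_dvd_iff.mpr <| by
      simp [Finset.sum_apply, sub_mul, Finset.sum_sub_distrib, hab]
  choose m hm using hX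
  have hm' : (X ^ 1 : (ZMod (p ^ r))[X]) • m =
      ∑ i, (Polynomial.C (a i) - Polynomial.C (b i)) • G i := by
    rw [pow_one]
    exact (funext hm).symm
  have hmem : m ∈ polynomialPart C := by
    rw [← X_pow_smul_mem_polynomialPart_iff 1, hm']
    exact Submodule.sum_mem _ fun i _ => Submodule.smul_mem _ _ (h.mem i)
  obtain ⟨c, hc, rfl⟩ := h.exists_digits_of_mem hp hmem
  have hCmem : ∀ x ∈ digits p r, Polynomial.C x ∈ digitPolynomials p r := by
    intro x hx i
    rw [coeff_C]
    split_ifs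
    · exact hx
    · exact zero_mem_digits hp r
  have key := h.digits_unique hp (a := fun i => Polynomial.C (a i))
    (b := fun i => Polynomial.C (b i) + X * c i) (fun i => hCmem _ (ha i)) (fun i e => by
      cases e with
      | zero => simpa using hb i
      | succ e => simpa using hc i e) (by
      simp only [add_smul, Finset.sum_add_distrib, mul_smul, ← Finset.smul_sum]
      rw [pow_one] at hm'
      rw [hm']
      simp [sub_smul])
  funext i
  simpa using congrArg (fun q => q.coeff 0) (congrFun key i)

/-- Combinations whose coefficients are power series in digits are unique. -/
theorem IsLeadingLift.powerSeries_digits_unique (hp : p.Prime)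
    (h : IsLeadingLift p (polynomialPart C) G v d) {U B : Fin k → PowerSeries (ZMod (p ^ r))}
    (hU : ∀ i t, PowerSeries.coeff t (U i) ∈ digits p r)
    (hB : ∀ i t, PowerSeries.coeff t (B i) ∈ digits p r)
    (hUB : U ᵥ* psMatrix G = B ᵥ* psMatrix G) : U = B := by
  suffices H : ∀ (t : ℕ) (U B : Fin k → PowerSeries (ZMod (p ^ r))),
      (∀ i t, PowerSeries.coeff t (U i) ∈ digits p r) →
      (∀ i t, PowerSeries.coeff t (B i) ∈ digits p r) → U ᵥ* psMatrix G = B ᵥ* psMatrix G →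
      ∀ i, PowerSeries.coeff t (U i) = PowerSeries.coeff t (B i) by
    funext i
    ext t
    exact H t U B hU hB hUB i
  have hconst : ∀ U B : Fin k → PowerSeries (ZMod (p ^ r)),
      (∀ i t, PowerSeries.coeff t (U i) ∈ digits p r) →
      (∀ i t, PowerSeries.coeff t (B i) ∈ digits p r) → U ᵥ* psMatrix G = B ᵥ* psMatrix G →
      (fun i => PowerSeries.constantCoeff (U i)) = fun i => PowerSeries.constantCoeff (B i) := by
    intro U B hU hB hUB
    refine h.eq_of_sum_mul_coeff_zero_eq hp (fun i => by simpa using hU i 0)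
      (fun i => by simpa using hB i 0) fun j => ?_
    rw [← constantCoeff_vecMul_psMatrix, hUB, constantCoeff_vecMul_psMatrix]
  intro t
  induction t with
  | zero =>
    intro U B hU hB hUB i
    simpa using congrFun (hconst U B hU hB hUB) i
  | succ t ih =>
    intro U B hU hB hUB i
    have hc := hconst U B hU hB hUB
    have key := ih (fun i => PowerSeries.mk fun t => PowerSeries.coeff (t + 1) (U i))
      (fun i => PowerSeries.mk fun t => PowerSeries.coeff (t + 1) (B i))
      (fun i t => by simpa using hU i (t + 1)) (fun i t => by simpa using hB i (t + 1)) (by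
        rw [eq_X_smul_shift_add_const U, eq_X_smul_shift_add_const B, add_vecMul, add_vecMul,
          smul_vecMul, smul_vecMul] at hUB
        have hc' : ∀ i, PowerSeries.constantCoeff (U i) = PowerSeries.constantCoeff (B i) :=
          congrFun hc
        simp only [hc', add_left_inj] at hUB
        funext j
        exact PowerSeries.X_mul_cancel (congrFun hUB j)) i
    simpa using key

/-- Splitting off the constant term of a vector of the code without negative powers of `D`. -/
theorem IsLeadingLift.exists_digits_add_X_smul (hp : p.Prime)
    (h : IsLeadingLift p (polynomialPart C) G v d) {l : ℕ}
    {G₀ : Matrix (Fin l) (Fin n) (ZMod (p ^ r))[X]} (hG₀ : IsGeneratorMatrix G₀ C)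
    {c : Fin n → PowerSeries (ZMod (p ^ r))} (hc : coeVec c ∈ C) :
    ∃ (a : Fin k → ZMod (p ^ r)) (c' : Fin n → PowerSeries (ZMod (p ^ r))),
      (∀ i, a i ∈ digits p r) ∧ coeVec c' ∈ C ∧
      c = psVec (fun i => Polynomial.C (a i)) ᵥ* psMatrix G +
        (PowerSeries.X : PowerSeries (ZMod (p ^ r))) • c' := by
  obtain ⟨m, hm, hmc⟩ := exists_mem_polynomialPart_coeff_zero hG₀ hc
  obtain ⟨b, hb, rfl⟩ := h.exists_digits_of_mem hp hm
  set A : Fin k → (ZMod (p ^ r))[X] := fun i => Polynomial.C ((b i).coeff 0) with hA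
  have hdvd : ∀ j, ∃ q, (c - psVec A ᵥ* psMatrix G) j = PowerSeries.X * q := by
    intro j
    refine PowerSeries.X_dvd_iff.mpr ?_
    rw [Pi.sub_apply, map_sub, constantCoeff_vecMul_psMatrix, ← hmc, sub_eq_zero,
      Finset.sum_apply, finsetSum_coeff]
    refine Finset.sum_congr rfl fun i _ => ?_
    rw [Pi.smul_apply, smul_eq_mul, mul_coeff_zero,
      ← PowerSeries.coeff_zero_eq_constantCoeff_apply, coeff_psVec, hA, coeff_C_zero]
  choose c' hc' using hdvd
  have hsub : (PowerSeries.X ^ 1 : PowerSeries (ZMod (p ^ r))) • c' =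
      c - psVec A ᵥ* psMatrix G := by
    rw [pow_one]
    exact (funext hc').symm
  refine ⟨fun i => (b i).coeff 0, c', fun i => hb i 0, ?_, ?_⟩
  · rw [← monomialD_smul_mem_iff ((1 : ℕ) : ℤ), ← coeVec_X_pow_smul, hsub]
    have : coeVec (c - psVec A ᵥ* psMatrix G) =
        coeVec c - coeVec (psVec A) ᵥ* laurentMatrix G := by
      rw [← coeVec_vecMul]
      funext j
      simp [coeVec]
    rw [this]
    exact C.sub_mem hc (vecMul_laurentMatrix_mem h.mem _)
  · rw [pow_one] at hsub
    rw [hsub, add_sub_cancel]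

/-- Every vector of the code without negative powers of `D` has a digit expansion. -/
theorem IsLeadingLift.exists_powerSeries_digits (hp : p.Prime)
    (h : IsLeadingLift p (polynomialPart C) G v d) {l : ℕ}
    {G₀ : Matrix (Fin l) (Fin n) (ZMod (p ^ r))[X]} (hG₀ : IsGeneratorMatrix G₀ C)
    {c : Fin n → PowerSeries (ZMod (p ^ r))} (hc : coeVec c ∈ C) :
    ∃ U : Fin k → PowerSeries (ZMod (p ^ r)),
      (∀ i t, PowerSeries.coeff t (U i) ∈ digits p r) ∧ c = U ᵥ* psMatrix G := by
  choose a c' ha hc' hac using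
    fun c : {c : Fin n → PowerSeries (ZMod (p ^ r)) // coeVec c ∈ C} =>
      h.exists_digits_add_X_smul hp hG₀ c.2
  let s : ℕ → {c : Fin n → PowerSeries (ZMod (p ^ r)) // coeVec c ∈ C} := fun t =>
    (fun c => ⟨c' c, hc' c⟩)^[t] ⟨c, hc⟩
  have hs : ∀ t, (s (t + 1)).1 = c' (s t) := fun t => by
    simp only [s, Function.iterate_succ_apply']
  -- the expansion of the remainder after `t` steps
  let U : ℕ → Fin k → PowerSeries (ZMod (p ^ r)) := fun t i =>
    PowerSeries.mk fun e => a (s (t + e)) i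
  have hUs : ∀ t, U t = (PowerSeries.X : PowerSeries (ZMod (p ^ r))) • U (t + 1) +
      psVec (fun i => Polynomial.C (a (s t) i)) := by
    intro t
    refine (eq_X_smul_shift_add_const (U t)).trans ?_
    congr 2
    · funext i
      ext e
      simp [U, add_comm, add_left_comm]
  have hrec : ∀ t, (s t).1 - U t ᵥ* psMatrix G = (PowerSeries.X : PowerSeries (ZMod (p ^ r))) •
      ((s (t + 1)).1 - U (t + 1) ᵥ* psMatrix G) := by
    intro t
    rw [hUs t, hs, add_vecMul, smul_vecMul, smul_sub]
    nth_rewrite 1 [hac (s t)]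
    abel
  have hzero : ∀ (e t : ℕ) (j : Fin n),
      PowerSeries.coeff e (((s t).1 - U t ᵥ* psMatrix G) j) = 0 := by
    intro e
    induction e with
    | zero =>
      intro t j
      rw [hrec, Pi.smul_apply, smul_eq_mul, PowerSeries.coeff_zero_X_mul]
    | succ e ih =>
      intro t j
      rw [hrec, Pi.smul_apply, smul_eq_mul, PowerSeries.coeff_succ_X_mul]
      exact ih (t + 1) j
  refine ⟨U 0, fun i t => by simpa [U] using ha _ i, ?_⟩
  funext j
  ext e
  have := hzero e 0 j
  rwa [Pi.sub_apply, map_sub, sub_eq_zero] at this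

/-! ### Properties of the encoder -/

theorem IsLeadingLift.image_eq (hp : p.Prime)
    (h : IsLeadingLift p (polynomialPart C) G v d) {l : ℕ}
    {G₀ : Matrix (Fin l) (Fin n) (ZMod (p ^ r))[X]} (hG₀ : IsGeneratorMatrix G₀ C) :
    (C : Set (Fin n → LaurentSeries (ZMod (p ^ r)))) =
      {w | ∃ u : Fin k → LaurentSeries (ZMod (p ^ r)),
        (∀ j, u j ∈ digitLaurent p r) ∧ w = u ᵥ* laurentMatrix G} := by
  ext w
  constructor
  · intro hw
    obtain ⟨N, c, hc, -⟩ := exists_monomialD_smul_eq_coeVec w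
    obtain ⟨U, hU, rfl⟩ := h.exists_powerSeries_digits hp hG₀
      (hc ▸ (monomialD_smul_mem_iff (N : ℤ)).mpr hw)
    refine ⟨monomialD (ZMod (p ^ r)) (-N) • coeVec U, fun i e => ?_, ?_⟩
    · rw [coeff_monomialD_smul, coeVec, Function.comp_apply, PowerSeries.coeff_coe]
      split_ifs
      · exact zero_mem_digits hp r
      · exact hU i _
    · rw [smul_vecMul, ← coeVec_vecMul, ← hc, monomialD_smul_smul, neg_add_cancel,
        monomialD_zero_smul]
  · rintro ⟨u, -, rfl⟩
    exact vecMul_laurentMatrix_mem h.mem u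

theorem IsLeadingLift.delayFree (hp : p.Prime)
    (h : IsLeadingLift p (polynomialPart C) G v d) : DelayFree p r G := by
  intro a ha h0
  refine congrFun (h.eq_of_sum_mul_coeff_zero_eq hp (b := 0) ha
    (fun _ => zero_mem_digits hp r) fun j => ?_)
  simpa [← coeff_zero_eq_eval_zero] using congrFun h0 j

theorem IsLeadingLift.pNoncatastrophic (hp : p.Prime)
    (h : IsLeadingLift p (polynomialPart C) G v d) : PNoncatastrophic p r G := by
  intro u hu
  constructor
  · intro hw
    obtain ⟨N, U, hU, hUcoeff⟩ := exists_monomialD_smul_eq_coeVec u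
    obtain ⟨N', m, hm⟩ := (weight_lt_top_iff _).mp (weight_monomialD_smul_lt_top hw N)
    have hm' : coeVec (((PowerSeries.X ^ N' : PowerSeries (ZMod (p ^ r))) • U) ᵥ* psMatrix G) =
        coeVec (psVec m) := by
      rw [← hm, coeVec_vecMul, coeVec_X_pow_smul, ← hU, smul_vecMul, smul_vecMul]
    have hmem : m ∈ polynomialPart C := by
      rw [mem_polynomialPart, ← hm', coeVec_vecMul]
      exact vecMul_laurentMatrix_mem h.mem _
    obtain ⟨b, hb, rfl⟩ := h.exists_digits_of_mem hp hmem
    -- the output is a polynomial combination, whose coefficients must be those of the input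
    have hUb : (PowerSeries.X ^ N' : PowerSeries (ZMod (p ^ r))) • U = psVec b := by
      refine h.powerSeries_digits_unique hp (fun i t => ?_)
        (fun i t => by rw [coeff_psVec]; exact hb i t) ?_
      · rw [Pi.smul_apply, smul_eq_mul, PowerSeries.coeff_X_pow_mul']
        split_ifs
        · rw [hUcoeff]
          exact hu i _
        · exact zero_mem_digits hp r
      · rw [coeVec_injective hm', ← psVec_vecMul, vecMul_eq_sum]
    refine (weight_lt_top_iff _).mpr ⟨N' + N, b, ?_⟩
    rw [← hUb, coeVec_X_pow_smul, ← hU, monomialD_smul_smul, Nat.cast_add]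
  · intro hw
    obtain ⟨N, b, hb⟩ := (weight_lt_top_iff u).mp hw
    refine (weight_lt_top_iff _).mpr ⟨N, b ᵥ* G, ?_⟩
    rw [← smul_vecMul, hb, psVec_vecMul, coeVec_vecMul]

end

end ConvCode

theorem mainTheorem2 (p r n : ℕ) (hp : p.Prime) (hr : 1 ≤ r)
    (C : Submodule (LaurentSeries (ZMod (p ^ r))) (Fin n → LaurentSeries (ZMod (p ^ r))))
    (hC : ConvCode.IsFreeConvolutionalCode C) :
    ∃ (k : ℕ) (G : Matrix (Fin k) (Fin n) (Polynomial (ZMod (p ^ r)))),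
      ConvCode.IsMinimalPEncoder p r G C := by
  obtain ⟨l, G₀, hG₀, -⟩ := hC
  have : NeZero (p ^ r) := ⟨pow_ne_zero _ hp.ne_zero⟩
  have hnil : ∃ s : ℕ, (p : ZMod (p ^ r)) ^ s = 0 :=
    ⟨r, by rw [← Nat.cast_pow, ZMod.natCast_self]⟩
  obtain ⟨k, g, v, d, h⟩ := ConvCode.exists_isLeadingLift hnil (ConvCode.polynomialPart C)
  exact ⟨k, Matrix.of g,
    ⟨h.pLinearIndependent hp, h.isPGeneratorSequence hp, h.image_eq hp hG₀⟩,
    h.delayFree hp, h.pNoncatastrophic hp, h.pLinearIndependentConst_leadingRowCoeff hp⟩
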